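/- Let $F=\mathbb F_q$ be a finite field, let $n\ge 0$, let $\Phi_q\subset F[X]$ be the set of monic irreducible polynomials and $\mathcal P$ the set of integer partitions. A map $f:\Phi_q\to\mathcal P$ is said to correspond to a conjugacy class $C$ of $\operatorname{GL}_n(F)$ if, for $M\in C$, the $F[X]$-module $F^n$ on which $X$ acts as $M$ is isomorphic to $$\bigoplus_{\phi\in\Phi_q}\ \bigoplus_{j} F[X]/(\phi^{\lambda_{\phi,j}}),\qquad f(\phi)=(\lambda_{\phi,1},\lambda_{\phi,2},\dots).$$ For $\phi\in\Phi_q$ let $\phi_2(X)=\phi(\sqrt X)\,\phi(-\sqrt X)$, i.e. $\phi_2$ is the polynomial with $\phi_2(X^2)=\phi(X)\phi(-X)$; up to sign, it is the monic polynomial whose roots are the squares of the roots of $\phi$. For a partition $\lambda=(\lambda_1,\dots,\lambda_i)$ put $\lambda'=\lambda$ if $q$ is odd, and let $\lambda'$ be the partition with parts $$\lfloor(\lambda_1+1)/2\rfloor,\ \lfloor\lambda_1/2\rfloor,\ \dots,\ \lfloor(\lambda_i+1)/2\rfloor,\ \lfloor\lambda_i/2\rfloor$$ (parts equal to $0$ being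 dropped) if $q$ is even. Let $f:\Phi_q\to\mathcal P$ correspond to the conjugacy class $C$ of $\operatorname{GL}_n(F)$, and let $C^2$ be the conjugacy class containing the squares of the elements of $C$. Then exactly one map $f^2:\Phi_q\to\mathcal P$ corresponds to $C^2$, and it is obtained from $f$ as follows: each $\phi\in\Phi_q$ contributes the partition $f(\phi)'$ to every irreducible factor of $\phi_2$, the factors being counted with multiplicity, and the parts of all the partitions contributed to the same polynomial are grouped into one partition. That is, for every $\psi\in\Phi_q$, $f^2(\psi)$ is the multiset union $$f^2(\psi)=\bigsqcup_{\phi\in\Phi_q}\ \underbrace{f(\phi)'\sqcup\dots\sqcup f(\phi)'}_{m_\psi(\phi_2)\text{ times}},$$ where $m_\psi(\phi_2)$ is the multiplicity of $\psi$ as a factor of $\phi_2$. -/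

import Mathlib

open Polynomial DirectSum
open scoped MatrixGroups

/-- The set `Φ_q` of monic irreducible polynomials over `F`. -/
abbrev MonicIrreducible (F : Type*) [Field F] : Type _ :=
  {φ : F[X] // φ.Monic ∧ Irreducible φ}

/-- The set of integer partitions (of arbitrary size): finite multisets of positive integers.
The addition groups the parts of two partitions into one partition, the zero element is the
empty partition. -/
def intPartitions : AddSubmonoid (Multiset ℕ) where
  carrier := {m | ∀ k ∈ m, 0 < k}
  zero_mem' := by simp
  add_mem' := by
    intro a b ha hb k hk
    rcases Multiset.mem_add.1 hk with h | h
    · exact ha k h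
    · exact hb k h

/-- An integer partition. -/
abbrev IntPartition : Type := intPartitions

/-- The partition with parts `⌊(k + 1) / 2⌋` and `⌊k / 2⌋`, for all the parts `k` of the given
partition (counted with multiplicity); parts equal to zero are dropped. -/
def IntPartition.halve (l : IntPartition) : IntPartition :=
  ⟨((l : Multiset ℕ).map (fun k => (k + 1) / 2) +
      (l : Multiset ℕ).map (fun k => k / 2)).filter (fun k => 0 < k),
    fun _ hk => (Multiset.mem_filter.1 hk).2⟩

noncomputable section

/-- The polynomial `φ₂(X) = φ(√X) φ(-√X)`, that is, the polynomial such that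
`φ₂(X ^ 2) = φ(X) φ(-X)`; see `expand_squarePoly`. -/
def squarePoly {F : Type*} [Field F] (φ : F[X]) : F[X] :=
  contract 2 (φ * φ.comp (-X))

theorem expand_squarePoly {F : Type*} [Field F] (φ : F[X]) :
    expand F 2 (squarePoly φ) = φ * φ.comp (-X) := by
  set p := φ * φ.comp (-X) with hp
  have hs : p.comp (-X) = p := by
    rw [hp, mul_comp, comp_assoc]
    simp [mul_comm]
  ext m
  rw [coeff_expand (by norm_num)]
  split_ifs with h
  · rw [squarePoly, coeff_contract (by norm_num), Nat.div_mul_cancel h]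
  · have hm : Odd m := by
      rw [← Nat.not_even_iff_odd, even_iff_two_dvd]; exact h
    by_cases h2 : (2 : F) = 0
    · have hneg : (-X : F[X]) = X := by
        have : (2 : F[X]) = 0 := by
          rw [← C_ofNat, h2, C_0]
        linear_combination (-X : F[X]) * this
      have hc : CharP F 2 := CharTwo.of_one_ne_zero_of_two_eq_zero one_ne_zero h2
      have hq : p = expand F 2 (φ.map (frobenius F 2)) := by
        rw [hp, hneg, comp_X, ← sq, ← map_frobenius_expand 2, ← map_expand]
      rw [hq, coeff_expand (by norm_num), if_neg h]
    · have hc := congrArg (fun r => coeff r m) hs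
      have hX : (-X : F[X]) = C (-1) * X := by simp
      simp only [hX, comp_C_mul_X_coeff, hm.neg_one_pow] at hc
      have : (2 : F) * p.coeff m = 0 := by linear_combination -hc
      exact ((mul_eq_zero.1 this).resolve_left h2).symm

/-- The map `f : Φ_q → {partitions}` corresponds to the matrix `M`: the `F[X]`-module on `F ^ n`
in which `X` acts as `M` is isomorphic to `⨁_φ ⨁_j F[X] / (φ ^ λ_{φ,j})`, where the `λ_{φ,j}` are
the parts of `f φ`. -/
def CorrespondsToMatrix {F : Type*} [Field F] {n : ℕ} (f : MonicIrreducible F → IntPartition)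
    (M : Matrix (Fin n) (Fin n) F) : Prop :=
  Nonempty (Module.AEval' (Matrix.toLin' M) ≃ₗ[F[X]]
    ⨁ φ : MonicIrreducible F, ⨁ k : (f φ : Multiset ℕ),
      F[X] ⧸ Ideal.span {(φ : F[X]) ^ (k : ℕ)})

/-- The map `f` corresponds to the conjugacy class `C` of `GL_n(F)`. -/
def CorrespondsToClass {F : Type*} [Field F] {n : ℕ} (f : MonicIrreducible F → IntPartition)
    (C : ConjClasses (GL (Fin n) F)) : Prop :=
  ∀ g ∈ C.carrier, CorrespondsToMatrix f (g : Matrix (Fin n) (Fin n) F)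

/-- The conjugacy class containing the squares of the elements of a conjugacy class. -/
def squareClass {G : Type*} [Group G] (C : ConjClasses G) : ConjClasses G :=
  Quotient.map (sa := IsConj.setoid G) (sb := IsConj.setoid G) (fun g => g ^ 2)
    (fun _ _ h => IsConj.pow 2 h) C

end

/-! Over a finite field the partitions attached to `M` can be read off from kernel sizes: `ψ(M) ^ j`
has kernel of size `q ^ (deg ψ * ∑ min(k, j))`, summed over the parts `k` at `ψ`, and these
truncated sums determine a partition (`IntPartition.ext_truncSum`). The kernel of `ψ(M ^ 2) ^ j` is
that of `ψ(X ^ 2) ^ j` at `M`, so it too can be computed from `f`: each `φ` dividing `ψ(X ^ 2)` with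
multiplicity `e` contributes `deg φ * ∑ min(k, j * e)`. Such a `φ` has `φ₂` associated to `ψ ^ m`
with `deg φ = m * deg ψ`, which produces the multiplicity `m`. For `q` odd and `φ ≠ X`, `e = 1` and
the partition is unchanged; for `q` even, `e = 2` and halving the parts absorbs the doubled bound.
`CorrespondsToMatrix.sq_iff` assembles these identities. -/

/-! ### Factors of `ψ(X ^ 2)` and of `φ₂`. -/

section SquarePoly

variable {F : Type*} [Field F]

theorem expand_dvd_expand_iff {p : ℕ} (hp : p ≠ 0) {f g : F[X]} :
    expand F p f ∣ expand F p g ↔ f ∣ g := by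
  refine ⟨fun ⟨h, e⟩ => ⟨contract p h, ?_⟩, map_dvd _⟩
  rw [mul_comm f, ← contract_mul_expand hp, mul_comm h, ← e, contract_expand _ hp]

theorem expand_two_comp_neg_X (ψ : F[X]) : (expand F 2 ψ).comp (-X) = expand F 2 ψ := by
  rw [expand_eq_comp_X_pow, comp_assoc]
  simp

theorem dvd_comp_neg_X {φ ψ : F[X]} (h : φ ∣ ψ) : φ.comp (-X) ∣ ψ.comp (-X) := by
  obtain ⟨r, rfl⟩ := h
  exact ⟨r.comp (-X), mul_comp _ _ _⟩

theorem comp_neg_X_dvd_expand_two {φ ψ : F[X]} (h : φ ∣ expand F 2 ψ) :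
    φ.comp (-X) ∣ expand F 2 ψ := by
  simpa [expand_two_comp_neg_X] using dvd_comp_neg_X h

theorem natDegree_comp_neg_X (φ : F[X]) : (φ.comp (-X)).natDegree = φ.natDegree := by
  rw [natDegree_comp, natDegree_neg, natDegree_X, mul_one]

theorem natDegree_squarePoly (φ : F[X]) : (squarePoly φ).natDegree = φ.natDegree := by
  by_cases h : φ = 0
  · subst h; simp [squarePoly, contract]
  have h2 := congrArg natDegree (expand_squarePoly φ)
  have hc : φ.comp (-X) ≠ 0 := by
    intro h0
    have := congrArg (fun r => r.comp (-X)) h0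
    simp only [comp_assoc, neg_comp, X_comp, neg_neg, comp_X, zero_comp] at this
    exact h this
  rw [natDegree_expand, natDegree_mul h hc, natDegree_comp_neg_X] at h2
  lia

/-- Everything is compared after substituting `X ^ 2`. An irreducible factor of `ψ(X ^ 2)` dividing
`φ(X) φ(-X)` is associated to `φ(X)` or `φ(-X)`, and `ψ(X ^ 2)` is invariant under `X ↦ -X`.
Conversely, the same invariance gives `φ₂ ∣ ψ ^ 2`. -/
theorem dvd_squarePoly_iff {φ ψ : F[X]} (hφ : Irreducible φ) (hψ : Irreducible ψ) :
    ψ ∣ squarePoly φ ↔ φ ∣ expand F 2 ψ := by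
  constructor
  · intro h
    have h1 := (expand_dvd_expand_iff two_ne_zero).2 h
    rw [expand_squarePoly] at h1
    have hu : ¬ IsUnit (expand F 2 ψ) := not_isUnit_of_natDegree_pos _ (by
      rw [natDegree_expand]; have := hψ.natDegree_pos; lia)
    obtain ⟨r, hr, hrψ⟩ := WfDvdMonoid.exists_irreducible_factor hu
      ((expand_ne_zero (by norm_num)).2 hψ.ne_zero)
    rcases hr.prime.dvd_or_dvd (hrψ.trans h1) with h2 | h2
    · exact (hr.dvd_symm hφ h2).trans hrψ
    · have h3 := dvd_comp_neg_X h2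
      rw [comp_assoc, neg_comp, X_comp, neg_neg, comp_X] at h3
      have h4 : r.comp (-X) ∣ expand F 2 ψ := comp_neg_X_dvd_expand_two hrψ
      obtain ⟨c, hc⟩ := h3
      rcases hφ.isUnit_or_isUnit hc with hu | hu
      · refine absurd hu (not_isUnit_of_natDegree_pos _ ?_)
        rw [natDegree_comp_neg_X]
        exact hr.natDegree_pos
      · rw [hc]
        exact hu.mul_right_dvd.2 h4
  · intro h
    have h1 : expand F 2 (squarePoly φ) ∣ expand F 2 (ψ ^ 2) := by
      rw [expand_squarePoly, map_pow, sq]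
      exact mul_dvd_mul h (comp_neg_X_dvd_expand_two h)
    rw [expand_dvd_expand_iff (by norm_num)] at h1
    obtain ⟨i, hi, hs⟩ := (dvd_prime_pow hψ.prime 2).1 h1
    have hi0 : i ≠ 0 := by
      rintro rfl
      have := natDegree_eq_of_degree_eq (degree_eq_degree_of_associated hs)
      rw [natDegree_squarePoly] at this
      simp only [pow_zero, natDegree_one] at this
      exact hφ.natDegree_pos.ne' this
    exact (dvd_pow_self ψ hi0).trans hs.symm.dvd

/-- Since `φ₂ ∣ ψ ^ 2`, `φ₂` is a power of `ψ` up to a unit, and it has the degree of `φ`. -/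
theorem natDegree_eq_mul_multiplicity_squarePoly {φ ψ : F[X]} (hψ : Irreducible ψ)
    (h : φ ∣ expand F 2 ψ) :
    φ.natDegree = ψ.natDegree * multiplicity ψ (squarePoly φ) := by
  have h1 : expand F 2 (squarePoly φ) ∣ expand F 2 (ψ ^ 2) := by
    rw [expand_squarePoly, map_pow, sq]
    exact mul_dvd_mul h (comp_neg_X_dvd_expand_two h)
  rw [expand_dvd_expand_iff (by norm_num)] at h1
  obtain ⟨i, hi, hs⟩ := (dvd_prime_pow hψ.prime 2).1 h1
  rw [multiplicity_eq_of_associated_right hs,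
    multiplicity_pow_self hψ.ne_zero hψ.not_isUnit,
    ← natDegree_squarePoly φ, natDegree_eq_of_degree_eq (degree_eq_degree_of_associated hs),
    natDegree_pow, mul_comm]

theorem multiplicity_squarePoly_eq_zero {φ ψ : F[X]} (hφ : Irreducible φ)
    (hψ : Irreducible ψ) (h : ¬ φ ∣ expand F 2 ψ) : multiplicity ψ (squarePoly φ) = 0 := by
  rw [multiplicity_eq_zero, dvd_squarePoly_iff hφ hψ]
  exact h

/-- The derivative `2 X ψ'(X ^ 2)` is coprime to `ψ(X ^ 2)` unless `ψ` is associated to `X`, so `ψ(X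
^ 2)` is squarefree. -/
theorem multiplicity_expand_two_of_two_ne_zero [PerfectField F] (h2 : (2 : F) ≠ 0)
    {φ ψ : F[X]} (hφ : Irreducible φ) (hφX : ¬ φ ∣ X) (hψ : Irreducible ψ)
    (h : φ ∣ expand F 2 ψ) : multiplicity φ (expand F 2 ψ) = 1 := by
  have hψX : ¬ X ∣ ψ := by
    intro hX
    have := (expand_dvd_expand_iff (F := F) (p := 2) (by norm_num)).2
      (irreducible_X.dvd_symm hψ hX)
    rw [expand_X] at this
    exact hφX (hφ.prime.dvd_of_dvd_pow (h.trans this))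
  have hsep : (expand F 2 ψ).Separable := by
    have h1 : IsCoprime ψ (derivative ψ) := PerfectField.separable_of_irreducible hψ
    have h3 : ¬ X ∣ expand F 2 ψ := by
      rw [X_dvd_iff] at hψX ⊢
      simpa [coeff_expand] using hψX
    have h4 : IsCoprime (expand F 2 ψ) (X : F[X]) :=
      ((irreducible_X.coprime_iff_not_dvd).2 h3).symm
    rw [Separable, derivative_expand]
    refine ((isCoprime_expand (by norm_num)).2 h1).mul_right ?_
    refine IsCoprime.mul_right ?_ (by simpa using h4)
    have hu : IsUnit ((2 : ℕ) : F[X]) := by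
      have := (isUnit_iff_ne_zero.2 h2).map (C : F →+* F[X])
      rwa [C_ofNat] at this
    obtain ⟨c, hc⟩ := hu.exists_left_inv
    exact ⟨0, c, by rw [zero_mul, zero_add, hc]⟩
  have hsq := hsep.squarefree
  have h0 : expand F 2 ψ ≠ 0 := (expand_ne_zero (by norm_num)).2 hψ.ne_zero
  have hfin := FiniteMultiplicity.of_not_isUnit hφ.not_isUnit h0
  have h5 : multiplicity φ (expand F 2 ψ) < 2 := by
    rw [hfin.multiplicity_lt_iff_not_dvd, sq]
    exact fun h => hφ.not_isUnit (hsq _ h)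
  have h6 : multiplicity φ (expand F 2 ψ) ≠ 0 := by
    rw [Ne, multiplicity_eq_zero, not_not]; exact h
  lia

/-- Taking square roots of the coefficients of `ψ` gives an irreducible `r` with `ψ(X ^ 2) = r ^ 2`.
-/
theorem multiplicity_expand_two_of_charP_two [PerfectField F] [CharP F 2]
    {φ ψ : F[X]} (hφ : Irreducible φ) (hψ : Irreducible ψ) (h : φ ∣ expand F 2 ψ) :
    multiplicity φ (expand F 2 ψ) = 2 ∧ φ.natDegree = ψ.natDegree := by
  obtain ⟨r, rfl⟩ := (mapEquiv (frobeniusEquiv F 2)).surjective ψ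
  have hr : Irreducible r := (MulEquiv.irreducible_iff (mapEquiv (frobeniusEquiv F 2))).1 hψ
  have hm : mapEquiv (frobeniusEquiv F 2) r = r.map (frobenius F 2) := rfl
  have he : expand F 2 (mapEquiv (frobeniusEquiv F 2) r) = r ^ 2 := by
    rw [hm, ← map_expand, map_frobenius_expand]
  rw [he] at h ⊢
  have ha : Associated φ r :=
    hφ.associated_of_dvd hr (hφ.prime.dvd_of_dvd_pow h)
  refine ⟨?_, ?_⟩
  · rw [← multiplicity_eq_of_associated_right (ha.pow_pow (n := 2)),
      multiplicity_pow_self hφ.ne_zero hφ.not_isUnit]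
  · rw [hm, natDegree_map, natDegree_eq_of_degree_eq (degree_eq_degree_of_associated ha)]

end SquarePoly

/-! ### Sizes of torsion submodules. -/

section CardTorsion

theorem dvd_mul_iff_of_prime {R : Type*} [CommRing R] [IsDomain R] {φ p : R} (hφ : Prime φ)
    (hp : FiniteMultiplicity φ p) (k : ℕ) (a : R) :
    φ ^ k ∣ p * a ↔ φ ^ (k - multiplicity φ p) ∣ a := by
  obtain ⟨c, hc, hcd⟩ := hp.exists_eq_pow_mul_and_not_dvd
  set m := multiplicity φ p
  rw [hc, mul_assoc]
  rcases le_total k m with h | h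
  · rw [Nat.sub_eq_zero_of_le h, pow_zero]
    exact iff_of_true ((pow_dvd_pow _ h).trans (dvd_mul_right _ _)) (one_dvd _)
  · obtain ⟨d, rfl⟩ := Nat.exists_eq_add_of_le h
    rw [pow_add, mul_dvd_mul_iff_left (pow_ne_zero _ hφ.ne_zero), Nat.add_sub_cancel_left]
    refine ⟨fun h => ?_, fun h => h.mul_left _⟩
    exact hφ.pow_dvd_of_dvd_mul_left _ hcd h

variable {F : Type*} [Field F]

theorem natCard_quotient_span_singleton {f : F[X]} (hf : f ≠ 0) :
    Nat.card (F[X] ⧸ Ideal.span {f}) = Nat.card F ^ f.natDegree := by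
  have : Module.Finite F (F[X] ⧸ Ideal.span {f}) := by
    have := (AdjoinRoot.powerBasis hf).finite
    exact this
  rw [Module.natCard_eq_pow_finrank (K := F), finrank_quotient_span_eq_natDegree]

theorem natCard_torsion_quotient_span_pow {φ p : F[X]} (hφ : Irreducible φ) (hp : p ≠ 0) (k : ℕ) :
    Nat.card {x : F[X] ⧸ Ideal.span {φ ^ k} // p • x = 0} =
      Nat.card F ^ (φ.natDegree * min k (multiplicity φ p)) := by
  have hfin := FiniteMultiplicity.of_not_isUnit hφ.not_isUnit hp
  set m := multiplicity φ p with hm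
  -- The `p`-torsion is the range of multiplication by `φ ^ (k - m)`, whose kernel is generated by
  -- `φ ^ min k m`.
  let T : F[X] →ₗ[F[X]] F[X] ⧸ Ideal.span {φ ^ k} :=
    (Submodule.mkQ _).comp (LinearMap.mulLeft F[X] (φ ^ (k - m)))
  have hT (b : F[X]) : T b = Ideal.Quotient.mk (Ideal.span {φ ^ k}) (φ ^ (k - m) * b) := rfl
  have hker : LinearMap.ker T = Ideal.span {φ ^ min k m} := by
    ext b
    rw [LinearMap.mem_ker, hT, Ideal.Quotient.eq_zero_iff_mem, Ideal.mem_span_singleton,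
      Ideal.mem_span_singleton]
    have : φ ^ k = φ ^ (k - m) * φ ^ min k m := by
      rw [← pow_add]
      congr 1
      lia
    rw [this]
    exact mul_dvd_mul_iff_left (pow_ne_zero _ hφ.ne_zero)
  have hrange (x) : x ∈ LinearMap.range T ↔ p • x = 0 := by
    obtain ⟨a, rfl⟩ := Ideal.Quotient.mk_surjective x
    have h1 : p • Ideal.Quotient.mk (Ideal.span {φ ^ k}) a =
      Ideal.Quotient.mk (Ideal.span {φ ^ k}) (p * a) := rfl
    rw [h1, Ideal.Quotient.eq_zero_iff_mem, Ideal.mem_span_singleton,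
      dvd_mul_iff_of_prime hφ.prime hfin, LinearMap.mem_range]
    constructor
    · rintro ⟨b, hb⟩
      rw [hT, Ideal.Quotient.eq, Ideal.mem_span_singleton] at hb
      have h2 := (pow_dvd_pow φ (Nat.sub_le k m)).trans hb
      exact (dvd_sub_right (dvd_mul_right _ _)).1 h2
    · rintro ⟨b, rfl⟩
      exact ⟨b, rfl⟩
  rw [← Nat.card_congr (Equiv.subtypeEquivRight hrange),
    show Nat.card {x // x ∈ LinearMap.range T} = Nat.card (F[X] ⧸ LinearMap.ker T) from
      (Nat.card_congr T.quotKerEquivRange.toEquiv).symm, hker,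
    natCard_quotient_span_singleton (pow_ne_zero _ hφ.ne_zero), natDegree_pow, mul_comm]

theorem natCard_torsion_congr {R N N' : Type*} [Semiring R] [AddCommMonoid N] [AddCommMonoid N']
    [Module R N] [Module R N'] (e : N ≃ₗ[R] N') (p : R) :
    Nat.card {x : N // p • x = 0} = Nat.card {x : N' // p • x = 0} :=
  Nat.card_congr (e.toEquiv.subtypeEquiv fun x => by simp [← map_smul])

theorem natCard_torsion_directSum {R ι : Type*} [Fintype ι] [Semiring R] (N : ι → Type*)
    [∀ i, AddCommMonoid (N i)] [∀ i, Module R (N i)] (p : R) :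
    Nat.card {x : ⨁ i, N i // p • x = 0} = ∏ i, Nat.card {x : N i // p • x = 0} := by
  rw [natCard_torsion_congr (DirectSum.linearEquivFunOnFintype R ι N), ← Nat.card_pi]
  refine Nat.card_congr ((Equiv.subtypeEquivRight fun x => ?_).trans
    (Equiv.subtypePiEquivPi (p := fun i (x : N i) => p • x = 0)))
  exact funext_iff

end CardTorsion

/-! ### Truncated sums of partitions. -/

/-- The sum of `min k j` over the parts `k` of a partition. -/
def IntPartition.truncSum (j : ℕ) : IntPartition →+ ℕ where
  toFun l := ((l : Multiset ℕ).map (min · j)).sum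
  map_zero' := by simp
  map_add' a b := by simp

theorem IntPartition.truncSum_apply (j : ℕ) (l : IntPartition) :
    truncSum j l = ((l : Multiset ℕ).map (min · j)).sum := rfl

theorem IntPartition.truncSum_succ (j : ℕ) (l : IntPartition) :
    truncSum (j + 1) l = truncSum j l + (l : Multiset ℕ).countP (j < ·) := by
  simp only [truncSum_apply]
  generalize (l : Multiset ℕ) = s
  induction s using Multiset.induction_on with
  | empty => simp
  | cons a s ih =>
    simp only [Multiset.map_cons, Multiset.sum_cons, Multiset.countP_cons, ih]
    split_ifs <;> lia

/-- First differences in `j` count the parts exceeding `j`; second differences give the multiplicity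
of each positive part. -/
theorem IntPartition.ext_truncSum {a b : IntPartition} (h : ∀ j, truncSum j a = truncSum j b) :
    a = b := by
  have hc (j : ℕ) : (a : Multiset ℕ).countP (j < ·) = (b : Multiset ℕ).countP (j < ·) := by
    have := h (j + 1)
    rw [truncSum_succ, truncSum_succ, h j] at this
    lia
  have key (s : Multiset ℕ) (j : ℕ) :
      s.countP (j < ·) = s.countP (j + 1 < ·) + s.count (j + 1) := by
    induction s using Multiset.induction_on with
    | empty => simp
    | cons a s ih =>
      simp only [Multiset.countP_cons, Multiset.count_cons, ih]
      split_ifs <;> lia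
  refine Subtype.ext (Multiset.ext.2 fun k => ?_)
  cases k with
  | zero =>
    rw [Multiset.count_eq_zero.2 fun h0 => (a.2 0 h0).ne rfl,
      Multiset.count_eq_zero.2 fun h0 => (b.2 0 h0).ne rfl]
  | succ k =>
    have h1 := key a k
    have h2 := key b k
    rw [hc, hc (k + 1)] at h1
    lia

/-- Part by part, `min ((k + 1) / 2) j + min (k / 2) j = min k (2 * j)`; dropped zeros contribute
nothing. -/
theorem IntPartition.truncSum_halve (j : ℕ) (l : IntPartition) :
    truncSum j l.halve = truncSum (2 * j) l := by
  have hz (s : Multiset ℕ) :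
      ((s.filter (0 < ·)).map (min · j)).sum = (s.map (min · j)).sum := by
    induction s using Multiset.induction_on with
    | empty => simp
    | cons a s ih =>
      rw [Multiset.filter_cons]
      split_ifs with ha
      · simpa using ih
      · obtain rfl : a = 0 := by lia
        simpa using ih
  simp only [truncSum_apply, halve]
  rw [hz]
  generalize (l : Multiset ℕ) = s
  induction s using Multiset.induction_on with
  | empty => simp
  | cons a s ih =>
    simp only [Multiset.map_add, Multiset.sum_add, Multiset.map_cons, Multiset.sum_cons] at ih ⊢
    lia

/-! ### Reindexing direct sums. -/

noncomputable section DirectSumIndex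

variable {R : Type*} [Semiring R]

/-- Reindexing a direct sum along an equivalence of the index types. -/
def DirectSum.linearEquivOfEquiv {ι κ : Type*} {N : ι → Type*} {N' : κ → Type*}
    [∀ i, AddCommMonoid (N i)] [∀ i, Module R (N i)] [∀ k, AddCommMonoid (N' k)]
    [∀ k, Module R (N' k)] (σ : κ ≃ ι) (h : ∀ k, N' k ≃ₗ[R] N (σ k)) :
    (⨁ k, N' k) ≃ₗ[R] ⨁ i, N i :=
  (DFinsupp.mapRange.linearEquiv h).trans (DirectSum.lequivCongrLeft R (M := N) σ.symm).symm

open scoped Classical in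
/-- Summands that are trivial may be omitted from a finite direct sum. -/
def DirectSum.linearEquivSubtype {ι : Type*} [Fintype ι] (N : ι → Type*)
    [∀ i, AddCommMonoid (N i)] [∀ i, Module R (N i)] (P : ι → Prop)
    (h : ∀ i, ¬ P i → Subsingleton (N i)) : (⨁ i : {i // P i}, N i) ≃ₗ[R] ⨁ i, N i :=
  (DirectSum.linearEquivFunOnFintype R {i // P i} (fun i => N i)).trans <|
    LinearEquiv.trans
      { toFun := fun x i => if hi : P i then x ⟨i, hi⟩ else 0
        invFun := fun y i => y i
        map_add' := fun x y => by
          ext i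
          by_cases hi : P i <;> simp [hi]
        map_smul' := fun r x => by
          ext i
          by_cases hi : P i <;> simp [hi]
        left_inv := fun x => by
          ext i
          simp [i.2]
        right_inv := fun y => by
          ext i
          by_cases hi : P i
          · simp [hi]
          · have := h i hi
            exact Subsingleton.elim _ _ }
      (DirectSum.linearEquivFunOnFintype R ι N).symm

theorem Multiset.exists_equiv_map_univ {α : Type*} [Fintype α] (e : α → ℕ) :
    ∃ σ : (Finset.univ.val.map e).ToType ≃ α,
      ∀ x : (Finset.univ.val.map e).ToType, (x : ℕ) = e (σ x) := by
  classical
  have hb : Function.Bijective (fun x : (Finset.univ : Finset α).val.ToType => (x : α)) := by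
    refine (Fintype.bijective_iff_surjective_and_card _).2 ⟨fun a => ?_, ?_⟩
    · exact ⟨⟨a, ⟨0, Multiset.count_pos.2 (Finset.mem_univ a)⟩⟩, rfl⟩
    · rw [Multiset.card_coe]; rfl
  let τ := Equiv.ofBijective _ hb
  refine ⟨(Multiset.mapEquiv _ e).symm.trans τ, fun x => ?_⟩
  obtain ⟨y, rfl⟩ := (Multiset.mapEquiv _ e).surjective x
  rw [Multiset.mapEquiv_apply, Equiv.trans_apply, Equiv.symm_apply_apply]
  rfl

end DirectSumIndex

/-! ### Existence of the correspondence and its kernel sizes. -/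

section Correspondence

variable {F : Type*} [Field F] {n : ℕ}

theorem exists_monicIrreducible_associated {p : F[X]} (hp : Irreducible p) :
    ∃ φ : MonicIrreducible F, Associated (φ : F[X]) p := by
  refine ⟨⟨p * C p.leadingCoeff⁻¹, monic_mul_leadingCoeff_inv hp.ne_zero,
    irreducible_mul_leadingCoeff_inv.2 hp⟩, ?_⟩
  have hu : IsUnit (C p.leadingCoeff⁻¹) :=
    isUnit_C.2 (inv_ne_zero (leadingCoeff_ne_zero.2 hp.ne_zero)).isUnit
  exact (associated_mul_unit_right p _ hu).symm

theorem exists_correspondsToMatrix (M : Matrix (Fin n) (Fin n) F) :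
    ∃ f : MonicIrreducible F → IntPartition, CorrespondsToMatrix f M := by
  classical
  obtain ⟨ι, _, p, hp, e, ⟨E⟩⟩ := Module.equiv_directSum_of_isTorsion
    (Module.AEval.isTorsion_of_finiteDimensional F (Fin n → F) (Matrix.toLin' M))
  choose φ hφ using fun i => exists_monicIrreducible_associated (hp i)
  -- The structure theorem allows zero exponents and associated primes: the former are discarded,
  -- the latter grouped by their monic representative.
  let fib (ψ : MonicIrreducible F) := {i : {i // 0 < e i} // φ i = ψ}
  let f (ψ : MonicIrreducible F) : IntPartition :=
    ⟨(Finset.univ : Finset (fib ψ)).val.map (fun i => e i.1), fun k hk => by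
      obtain ⟨i, -, rfl⟩ := Multiset.mem_map.1 hk
      exact i.1.2⟩
  choose σ hσ using fun ψ => Multiset.exists_equiv_map_univ (fun i : fib ψ => e i.1)
  have E₁ : (⨁ i : {i // 0 < e i}, F[X] ⧸ Submodule.span F[X] {p i ^ e i}) ≃ₗ[F[X]]
      ⨁ i, F[X] ⧸ Submodule.span F[X] {p i ^ e i} := by
    refine DirectSum.linearEquivSubtype (fun i => F[X] ⧸ Submodule.span F[X] {p i ^ e i})
      (fun i => 0 < e i) fun i hi => ?_
    have h0 : e i = 0 := by lia
    rw [Submodule.Quotient.subsingleton_iff, h0, pow_zero]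
    exact Ideal.span_singleton_one
  suffices E₂ : (⨁ k : (Σ ψ : MonicIrreducible F, (f ψ : Multiset ℕ)),
      F[X] ⧸ Ideal.span {(k.1 : F[X]) ^ (k.2 : ℕ)}) ≃ₗ[F[X]]
      ⨁ i : {i // 0 < e i}, F[X] ⧸ Submodule.span F[X] {p i ^ e i} from
    ⟨f, ⟨((E.trans E₁.symm).trans E₂.symm).trans (DirectSum.sigmaLcurryEquiv F[X]
      (δ := fun (ψ : MonicIrreducible F) (k : (f ψ : Multiset ℕ)) =>
        F[X] ⧸ Ideal.span {(ψ : F[X]) ^ (k : ℕ)}))⟩⟩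
  refine DirectSum.linearEquivOfEquiv
    ((Equiv.sigmaCongrRight σ).trans (Equiv.sigmaFiberEquiv fun i : {i // 0 < e i} => φ i))
    fun k => ?_
  refine Submodule.quotEquivOfEq _ _ ?_
  obtain ⟨ψ, k⟩ := k
  obtain ⟨k, rfl⟩ := (σ ψ).symm.surjective k
  have hk : φ k.1 = ψ := k.2
  change Ideal.span {(ψ : F[X]) ^ ((σ ψ).symm k : ℕ)} =
    Ideal.span {p (σ ψ ((σ ψ).symm k)).1 ^ e (σ ψ ((σ ψ).symm k)).1}
  rw [hσ ψ, Equiv.apply_symm_apply, Ideal.span_singleton_eq_span_singleton]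
  have ha := hφ k.1
  have hk' : (φ k.1 : F[X]) = ψ := congrArg Subtype.val hk
  rw [hk'] at ha
  exact ha.pow_pow

theorem CorrespondsToMatrix.nonempty_sigma {f : MonicIrreducible F → IntPartition}
    {M : Matrix (Fin n) (Fin n) F} (hf : CorrespondsToMatrix f M) :
    Nonempty (Module.AEval' (Matrix.toLin' M) ≃ₗ[F[X]]
      ⨁ i : (Σ φ : MonicIrreducible F, (f φ : Multiset ℕ)),
        F[X] ⧸ Ideal.span {(i.1 : F[X]) ^ (i.2 : ℕ)}) := by
  classical
  obtain ⟨E⟩ := hf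
  exact ⟨E.trans (DirectSum.sigmaLcurryEquiv F[X]
    (δ := fun (ψ : MonicIrreducible F) (k : (f ψ : Multiset ℕ)) =>
      F[X] ⧸ Ideal.span {(ψ : F[X]) ^ (k : ℕ)})).symm⟩

/-- Both modules have underlying space `F ^ n`, on which `p(M ^ 2)` is `p(X ^ 2)` evaluated at `M`.
-/
theorem natCard_torsion_sq (M : Matrix (Fin n) (Fin n) F) (p : F[X]) :
    Nat.card {x : Module.AEval' (Matrix.toLin' (M ^ 2)) // p • x = 0} =
      Nat.card {x : Module.AEval' (Matrix.toLin' M) // expand F 2 p • x = 0} := by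
  have h (v : Fin n → F) :
      p • Module.AEval'.of (Matrix.toLin' (M ^ 2)) v = 0 ↔
        expand F 2 p • Module.AEval'.of (Matrix.toLin' M) v = 0 := by
    rw [← Module.AEval.of_aeval_smul, ← Module.AEval.of_aeval_smul, expand_aeval,
      Matrix.toLin'_pow, LinearEquiv.map_eq_zero_iff, LinearEquiv.map_eq_zero_iff]
  exact Nat.card_congr
    (((Module.AEval'.of (Matrix.toLin' (M ^ 2))).symm.trans
      (Module.AEval'.of (Matrix.toLin' M))).toEquiv.subtypeEquiv fun x => h x)

variable [Finite F]

theorem CorrespondsToMatrix.finite_sigma {f : MonicIrreducible F → IntPartition}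
    {M : Matrix (Fin n) (Fin n) F} (hf : CorrespondsToMatrix f M) :
    Finite (Σ φ : MonicIrreducible F, (f φ : Multiset ℕ)) := by
  classical
  obtain ⟨E⟩ := hf.nonempty_sigma
  have : Finite (Module.AEval' (Matrix.toLin' M)) := inferInstanceAs (Finite (Fin n → F))
  have : Finite (Π₀ i : (Σ φ : MonicIrreducible F, (f φ : Multiset ℕ)),
      F[X] ⧸ Ideal.span {(i.1 : F[X]) ^ (i.2 : ℕ)}) := Finite.of_equiv _ E.toEquiv
  -- The class of `1` is nonzero in each summand, so the indices inject into the finite module.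
  refine Finite.of_injective _ (DFinsupp.single_left_injective
    (β := fun i : (Σ φ : MonicIrreducible F, (f φ : Multiset ℕ)) =>
        F[X] ⧸ Ideal.span {(i.1 : F[X]) ^ (i.2 : ℕ)}) (b := fun i => 1) fun i => ?_)
  have hk : 0 < (i.2 : ℕ) := (f i.1).2 _ (Multiset.coe_mem)
  rw [← map_one (Ideal.Quotient.mk _), Ne, Ideal.Quotient.eq_zero_iff_mem,
    Ideal.mem_span_singleton]
  exact fun h => i.1.2.2.not_isUnit
    (isUnit_of_dvd_one ((dvd_pow_self _ hk.ne').trans h))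

theorem CorrespondsToMatrix.finite_support {f : MonicIrreducible F → IntPartition}
    {M : Matrix (Fin n) (Fin n) F} (hf : CorrespondsToMatrix f M) :
    (Function.support f).Finite := by
  have := hf.finite_sigma
  refine (Set.finite_range
    (Sigma.fst : (Σ φ : MonicIrreducible F, (f φ : Multiset ℕ)) → _)).subset fun φ hφ => ?_
  have : (f φ : Multiset ℕ) ≠ 0 := fun h => hφ (Subtype.ext h)
  obtain ⟨k, hk⟩ := Multiset.exists_mem_of_ne_zero this
  exact ⟨⟨φ, ⟨k, ⟨0, Multiset.count_pos.2 hk⟩⟩⟩, rfl⟩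

theorem CorrespondsToMatrix.natCard_torsion {f : MonicIrreducible F → IntPartition}
    {M : Matrix (Fin n) (Fin n) F} (hf : CorrespondsToMatrix f M) {p : F[X]} (hp : p ≠ 0) :
    Nat.card {x : Module.AEval' (Matrix.toLin' M) // p • x = 0} =
      Nat.card F ^ ∑ᶠ φ : MonicIrreducible F,
        (φ : F[X]).natDegree * IntPartition.truncSum (multiplicity (φ : F[X]) p) (f φ) := by
  have := hf.finite_sigma
  have := Fintype.ofFinite (Σ φ : MonicIrreducible F, (f φ : Multiset ℕ))
  obtain ⟨E⟩ := hf.nonempty_sigma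
  rw [natCard_torsion_congr E, natCard_torsion_directSum]
  rw [Finset.prod_congr rfl fun i _ => natCard_torsion_quotient_span_pow i.1.2.2 hp i.2,
    Finset.prod_pow_eq_pow_sum]
  congr 1
  rw [finsum_eq_sum_of_support_subset (s := hf.finite_support.toFinset)]
  · have : (Finset.univ : Finset (Σ φ : MonicIrreducible F, (f φ : Multiset ℕ))) =
        hf.finite_support.toFinset.sigma fun _ => Finset.univ := by
      ext ⟨φ, k⟩
      simp only [Finset.mem_univ, Finset.mem_sigma, Set.Finite.mem_toFinset, and_true, true_iff]
      intro h0
      have hk : (k : ℕ) ∈ (f φ : Multiset ℕ) := Multiset.coe_mem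
      generalize (k : ℕ) = m at hk
      rw [h0] at hk
      exact absurd hk (Multiset.notMem_zero m)
    rw [this, Finset.sum_sigma]
    refine Finset.sum_congr rfl fun φ _ => ?_
    rw [IntPartition.truncSum_apply, ← Multiset.map_univ]
    exact (Finset.mul_sum Finset.univ
      (fun k : (f φ : Multiset ℕ) => min (k : ℕ) (multiplicity (φ : F[X]) p))
      (φ : F[X]).natDegree).symm
  · intro φ hφ
    rw [Set.Finite.coe_toFinset]
    intro h0
    refine hφ ?_
    simp only [h0, map_zero, mul_zero]

end Correspondence

/-! ### From kernel sizes to the class of squares. -/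

section SquareClass

variable {F : Type*} [Field F] {n : ℕ}

/-- A conjugate of `g ^ 2` is the square of a conjugate of `g`, so every member of the squared class
is the square of a member of `C`. -/
theorem correspondsToClass_squareClass_iff {f f₂ : MonicIrreducible F → IntPartition} {P : Prop}
    (C : ConjClasses (GL (Fin n) F)) (hf : CorrespondsToClass f C)
    (h : ∀ M : Matrix (Fin n) (Fin n) F, IsUnit M → CorrespondsToMatrix f M →
      (CorrespondsToMatrix f₂ (M ^ 2) ↔ P)) :
    CorrespondsToClass f₂ (squareClass C) ↔ P := by
  obtain ⟨g, rfl⟩ := ConjClasses.exists_rep C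
  constructor
  · intro h₂
    refine (h g g.isUnit (hf g ConjClasses.mem_carrier_mk)).1 ?_
    rw [← Units.val_pow_eq_pow_val]
    exact h₂ (g ^ 2) ConjClasses.mem_carrier_mk
  · intro hP k hk
    have hk' : ConjClasses.mk k = ConjClasses.mk (g ^ 2) := ConjClasses.mem_carrier_iff_mk_eq.1 hk
    obtain ⟨c, hc⟩ := isConj_iff.1 (ConjClasses.mk_eq_mk_iff_isConj.1 hk'.symm)
    have hk2 : k = (c * g * c⁻¹) ^ 2 := by rw [← hc, conj_pow]
    have hmem : c * g * c⁻¹ ∈ (ConjClasses.mk g).carrier := by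
      rw [ConjClasses.mem_carrier_iff_mk_eq, ConjClasses.mk_eq_mk_iff_isConj]
      exact (isConj_iff.2 ⟨c, rfl⟩).symm
    rw [hk2, Units.val_pow_eq_pow_val]
    exact (h _ (c * g * c⁻¹).isUnit (hf _ hmem)).2 hP

variable [Finite F]

theorem CorrespondsToMatrix.natCard_torsion_pow {f : MonicIrreducible F → IntPartition}
    {M : Matrix (Fin n) (Fin n) F} (hf : CorrespondsToMatrix f M) (ψ : MonicIrreducible F) (j : ℕ) :
    Nat.card {x : Module.AEval' (Matrix.toLin' M) // (ψ : F[X]) ^ j • x = 0} =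
      Nat.card F ^ ((ψ : F[X]).natDegree * IntPartition.truncSum j (f ψ)) := by
  rw [hf.natCard_torsion (pow_ne_zero _ ψ.2.2.ne_zero)]
  congr 1
  rw [finsum_eq_single _ ψ, multiplicity_pow_self ψ.2.2.ne_zero ψ.2.2.not_isUnit]
  intro φ hφ
  have h : ¬ (φ : F[X]) ∣ (ψ : F[X]) ^ j := fun h => hφ <| Subtype.ext <|
    eq_of_monic_of_associated φ.2.1 ψ.2.1
      (φ.2.2.associated_of_dvd ψ.2.2 (φ.2.2.prime.dvd_of_dvd_pow h))
  rw [multiplicity_eq_zero.2 h, IntPartition.truncSum_apply]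
  simp

theorem IntPartition.eq_zero_of_truncSum_one {l : IntPartition} (h : truncSum 1 l = 0) : l = 0 := by
  refine Subtype.ext (Multiset.eq_zero_of_forall_notMem fun k hk => ?_)
  rw [truncSum_apply, Multiset.sum_eq_zero_iff] at h
  have h1 := h _ (Multiset.mem_map_of_mem _ hk)
  have h2 : 0 < k := l.2 k hk
  lia

theorem CorrespondsToMatrix.eq_zero_of_dvd_X {f : MonicIrreducible F → IntPartition}
    {M : Matrix (Fin n) (Fin n) F} (hf : CorrespondsToMatrix f M) (hM : IsUnit M)
    {φ : MonicIrreducible F} (hφ : (φ : F[X]) ∣ X) : f φ = 0 := by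
  refine IntPartition.eq_zero_of_truncSum_one ?_
  have hX : (φ : F[X]) = X :=
    eq_of_monic_of_associated φ.2.1 monic_X (φ.2.2.associated_of_dvd irreducible_X hφ)
  have h := hf.natCard_torsion_pow φ 1
  have h1 : Nat.card {x : Module.AEval' (Matrix.toLin' M) // (φ : F[X]) ^ 1 • x = 0} = 1 := by
    rw [Nat.card_eq_one_iff_unique]
    refine ⟨⟨fun x y => ?_⟩, ⟨0, smul_zero _⟩⟩
    have key (x : Module.AEval' (Matrix.toLin' M)) (hx : (φ : F[X]) ^ 1 • x = 0) : x = 0 := by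
      obtain ⟨v, rfl⟩ := (Module.AEval'.of (Matrix.toLin' M)).surjective x
      rw [pow_one, hX, Module.AEval.X_smul_of, LinearEquiv.map_eq_zero_iff] at hx
      rw [LinearEquiv.map_eq_zero_iff]
      refine Matrix.mulVec_injective_of_isUnit hM ?_
      simpa using hx
    exact Subtype.ext ((key _ x.2).trans (key _ y.2).symm)
  have h2 := Nat.pow_right_injective (Finite.one_lt_card (α := F))
    ((pow_zero _).trans (h1.symm.trans h))
  exact (Nat.mul_eq_zero.1 h2.symm).resolve_left φ.2.2.natDegree_pos.ne'

/-- Let `f` correspond to `M`. If for all `φ` and `ψ` the contribution of the `φ`-primary part to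
the kernels of the powers of `ψ(X ^ 2)` agrees with that of `g φ` taken as often as `ψ` divides
`squarePoly φ`, then the correspondence for `M ^ 2` is obtained from `g`. -/
theorem CorrespondsToMatrix.sq_iff {f g : MonicIrreducible F → IntPartition}
    {M : Matrix (Fin n) (Fin n) F} (hf : CorrespondsToMatrix f M)
    (hg : ∀ φ, f φ = 0 → g φ = 0)
    (H : ∀ φ ψ : MonicIrreducible F, ∀ j, (φ : F[X]).natDegree *
      IntPartition.truncSum (j * multiplicity (φ : F[X]) (expand F 2 (ψ : F[X]))) (f φ) =
      (ψ : F[X]).natDegree * (multiplicity (ψ : F[X]) (squarePoly (φ : F[X])) *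
        IntPartition.truncSum j (g φ)))
    (f₂ : MonicIrreducible F → IntPartition) :
    CorrespondsToMatrix f₂ (M ^ 2) ↔ ∀ ψ : MonicIrreducible F, f₂ ψ =
      ∑ᶠ φ : MonicIrreducible F, multiplicity (ψ : F[X]) (squarePoly (φ : F[X])) • g φ := by
  have key (f₂ : MonicIrreducible F → IntPartition) (h₂ : CorrespondsToMatrix f₂ (M ^ 2))
      (ψ : MonicIrreducible F) : f₂ ψ =
      ∑ᶠ φ : MonicIrreducible F, multiplicity (ψ : F[X]) (squarePoly (φ : F[X])) • g φ := by
    refine IntPartition.ext_truncSum fun j => ?_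
    have h := h₂.natCard_torsion_pow ψ j
    have h0 : expand F 2 (ψ : F[X]) ≠ 0 := (expand_ne_zero (by norm_num)).2 ψ.2.2.ne_zero
    rw [natCard_torsion_sq, map_pow, hf.natCard_torsion (pow_ne_zero _ h0)] at h
    have h1 := Nat.pow_right_injective (Finite.one_lt_card (α := F)) h
    have hs : Function.HasFiniteSupport fun φ : MonicIrreducible F =>
        multiplicity (ψ : F[X]) (squarePoly (φ : F[X])) • g φ := by
      refine hf.finite_support.subset fun φ hφ h0 => hφ ?_
      simp only [hg φ h0, smul_zero]
    rw [map_finsum _ hs]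
    simp only [map_nsmul, smul_eq_mul]
    refine Nat.eq_of_mul_eq_mul_left ψ.2.2.natDegree_pos ?_
    rw [mul_finsum, ← h1]
    refine finsum_congr fun φ => ?_
    rw [FiniteMultiplicity.multiplicity_pow φ.2.2.prime
      (FiniteMultiplicity.of_not_isUnit φ.2.2.not_isUnit h0), H]
  refine ⟨key f₂, fun h => ?_⟩
  -- Some map corresponds to `M ^ 2`, and `key` forces it to be the one given by the formula.
  obtain ⟨f₃, h₃⟩ := exists_correspondsToMatrix (M ^ 2)
  rwa [show f₂ = f₃ from funext fun ψ => (h ψ).trans (key f₃ h₃ ψ).symm]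

theorem CorrespondsToMatrix.sq_iff_of_two_ne_zero (h2 : (2 : F) ≠ 0)
    {f : MonicIrreducible F → IntPartition} {M : Matrix (Fin n) (Fin n) F}
    (hf : CorrespondsToMatrix f M) (hM : IsUnit M) (f₂ : MonicIrreducible F → IntPartition) :
    CorrespondsToMatrix f₂ (M ^ 2) ↔ ∀ ψ : MonicIrreducible F, f₂ ψ =
      ∑ᶠ φ : MonicIrreducible F, multiplicity (ψ : F[X]) (squarePoly (φ : F[X])) • f φ := by
  refine hf.sq_iff (fun _ => id) (fun φ ψ j => ?_) f₂
  by_cases hX : (φ : F[X]) ∣ X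
  -- `φ = X` divides `X ^ 2` twice even in odd characteristic; it is harmless because `M` is
  -- invertible, so `f X` is empty.
  · simp [hf.eq_zero_of_dvd_X hM hX]
  by_cases h : (φ : F[X]) ∣ expand F 2 (ψ : F[X])
  · rw [multiplicity_expand_two_of_two_ne_zero h2 φ.2.2 hX ψ.2.2 h, mul_one,
      natDegree_eq_mul_multiplicity_squarePoly ψ.2.2 h, mul_assoc]
  · rw [multiplicity_eq_zero.2 h, multiplicity_squarePoly_eq_zero φ.2.2 ψ.2.2 h]
    simp [IntPartition.truncSum_apply]

theorem CorrespondsToMatrix.sq_iff_of_charP_two [CharP F 2]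
    {f : MonicIrreducible F → IntPartition} {M : Matrix (Fin n) (Fin n) F}
    (hf : CorrespondsToMatrix f M) (f₂ : MonicIrreducible F → IntPartition) :
    CorrespondsToMatrix f₂ (M ^ 2) ↔ ∀ ψ : MonicIrreducible F, f₂ ψ =
      ∑ᶠ φ : MonicIrreducible F,
        multiplicity (ψ : F[X]) (squarePoly (φ : F[X])) • (f φ).halve := by
  refine hf.sq_iff (fun φ h => ?_) (fun φ ψ j => ?_) f₂
  · rw [h]; rfl
  by_cases h : (φ : F[X]) ∣ expand F 2 (ψ : F[X])
  · rw [(multiplicity_expand_two_of_charP_two φ.2.2 ψ.2.2 h).1, mul_comm j,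
      natDegree_eq_mul_multiplicity_squarePoly ψ.2.2 h, IntPartition.truncSum_halve, mul_assoc]
  · rw [multiplicity_eq_zero.2 h, multiplicity_squarePoly_eq_zero φ.2.2 ψ.2.2 h]
    simp [IntPartition.truncSum_apply]

end SquareClass

theorem mainTheorem4 {F : Type*} [Field F] [Fintype F] (n : ℕ) (C : ConjClasses (GL (Fin n) F))
    (f : MonicIrreducible F → IntPartition) (hf : CorrespondsToClass f C) :
    (Odd (Fintype.card F) →
      ∀ f₂ : MonicIrreducible F → IntPartition, CorrespondsToClass f₂ (squareClass C) ↔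
        ∀ ψ : MonicIrreducible F, f₂ ψ =
          ∑ᶠ φ : MonicIrreducible F, multiplicity (ψ : F[X]) (squarePoly (φ : F[X])) • f φ) ∧
    (Even (Fintype.card F) →
      ∀ f₂ : MonicIrreducible F → IntPartition, CorrespondsToClass f₂ (squareClass C) ↔
        ∀ ψ : MonicIrreducible F, f₂ ψ =
          ∑ᶠ φ : MonicIrreducible F,
            multiplicity (ψ : F[X]) (squarePoly (φ : F[X])) • (f φ).halve) := by
  refine ⟨fun hF f₂ => ?_, fun hF f₂ => ?_⟩
  · have h2 : (2 : F) ≠ 0 := Ring.two_ne_zero fun h => by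
      have := FiniteField.even_card_iff_char_two.1 h
      have := Nat.odd_iff.1 hF
      lia
    exact correspondsToClass_squareClass_iff C hf fun M hM h => h.sq_iff_of_two_ne_zero h2 hM f₂
  · have : CharP F 2 := ringChar.of_eq
      (FiniteField.even_card_iff_char_two.2 (Nat.even_iff.1 hF))
    exact correspondsToClass_squareClass_iff C hf fun M _ h => h.sq_iff_of_charP_two f₂
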